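/- Let $X$ and $Y$ be infinite-dimensional complex Banach spaces. For a bounded linear operator $T$ on a complex Banach space, let $\alpha(T)=\dim\ker T$ and $\beta(T)=\operatorname{codim}\operatorname{ran} T$ (values in $\{0,1,2,\dots\}\cup\{\infty\}$). Call $T$ upper semi-Fredholm if $\operatorname{ran} T$ is closed and $\alpha(T)<\infty$; its index is then $\operatorname{ind}T=\alpha(T)-\beta(T)\in\mathbb Z\cup\{-\infty\}$. Call $T$ upper semi-Weyl if it is upper semi-Fredholm with $\operatorname{ind}T\le 0$. Put $$\rho_{uf}(T)=\{\lambda\in\mathbb C: T-\lambda I\text{ is upper semi-Fredholm}\},\qquad \sigma_{uw}(T)=\{\lambda\in\mathbb C: T-\lambda I\text{ is not upper semi-Weyl}\},$$ let $\sigma(T)$ be the spectrum of $T$, and let $\sigma_a(T)$ be the approximate point spectrum, i.e. the set of $\lambda\in\mathbb C$ such that $T-\lambda I$ is not bounded below. The ascent $a(T)$ is the least $n\ge 0$ with $\ker T^n=\ker T^{n+1}$ ($\infty$ if there is none). A point $\lambda\in\sigma_a(T)$ is a left pole of $T$ if $p=a(T-\lambda I)<\infty$ and $\operatorname{ran}\,(T-\lambda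 I)^{p+1}$ is closed; it is of finite rank if moreover $\alpha(T-\lambda I)<\infty$. Let $p_{00}^a(T)$ be the set of left poles of $T$ of finite rank. The operator $T$ satisfies property $(az)$ if $$\sigma(T)\setminus\sigma_{uw}(T)=p_{00}^a(T).$$ Two bounded operators $S$ on $X$ and $T$ on $Y$ have a shared stable sign index if for all $\lambda\in\rho_{uf}(S)$ and $\mu\in\rho_{uf}(T)$ the indices $\operatorname{ind}(S-\lambda I)$ and $\operatorname{ind}(T-\mu I)$ have the same sign, meaning that they are both $\le 0$ or both $\ge 0$. Suppose that the bounded linear operators $S$ on $X$ and $T$ on $Y$ satisfy property $(az)$ and have a shared stable sign index. Then $S\oplus T$, acting on $X\oplus Y$, satisfies property $(az)$. -/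

import Mathlib

namespace DirectSumAz

variable {E : Type*} [NormedAddCommGroup E] [NormedSpace ℂ E]

/-- The nullity `α(T) = dim N(T)`, with value `∞` when the kernel is infinite dimensional. -/
noncomputable def nullity (T : E →L[ℂ] E) : ℕ∞ :=
  Cardinal.toENat (Module.rank ℂ (LinearMap.ker (T : E →ₗ[ℂ] E)))

/-- The deficiency `β(T) = codim R(T)`, with value `∞` when the codimension is infinite. -/
noncomputable def deficiency (T : E →L[ℂ] E) : ℕ∞ :=
  Cardinal.toENat (Module.rank ℂ (E ⧸ LinearMap.range (T : E →ₗ[ℂ] E)))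

/-- `T` is upper semi-Fredholm: closed range and finite dimensional kernel. -/
def IsUpperSemiFredholm (T : E →L[ℂ] E) : Prop :=
  IsClosed (Set.range T) ∧ nullity T < ⊤

/-- The index `ind T = α(T) - β(T)`, as an extended real number. It is only used for upper
semi-Fredholm operators, where `α(T)` is finite and the index lies in `ℤ ∪ {-∞}`. -/
noncomputable def index (T : E →L[ℂ] E) : EReal :=
  (((nullity T : ENNReal)) : EReal) - ((deficiency T : ENNReal) : EReal)

/-- `T` is upper semi-Weyl: upper semi-Fredholm of index `≤ 0`. -/
def IsUpperSemiWeyl (T : E →L[ℂ] E) : Prop :=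
  IsUpperSemiFredholm T ∧ index T ≤ 0

/-- The operator `T - λ I`. -/
noncomputable def shift (T : E →L[ℂ] E) (z : ℂ) : E →L[ℂ] E :=
  T - z • ContinuousLinearMap.id ℂ E

/-- The complement `ρ_uf(T)` of the upper semi-Fredholm spectrum. -/
def upperSemiFredholmResolvent (T : E →L[ℂ] E) : Set ℂ :=
  {z | IsUpperSemiFredholm (shift T z)}

/-- The upper semi-Weyl spectrum `σ_uw(T)`. -/
def upperSemiWeylSpectrum (T : E →L[ℂ] E) : Set ℂ :=
  {z | ¬ IsUpperSemiWeyl (shift T z)}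

/-- The approximate point spectrum `σ_a(T)`: those `z` for which `T - z I` is not bounded below. -/
def approximateSpectrum (T : E →L[ℂ] E) : Set ℂ :=
  {z | ¬ ∃ c : ℝ, 0 < c ∧ ∀ x : E, c * ‖x‖ ≤ ‖shift T z x‖}

/-- The ascent `a(T) = inf {n : N(Tⁿ) = N(Tⁿ⁺¹)}`, with value `∞` when there is no such `n`. -/
noncomputable def ascent (T : E →L[ℂ] E) : ℕ∞ :=
  sInf {m : ℕ∞ | ∃ n : ℕ, m = n ∧
    LinearMap.ker ((T ^ n : E →L[ℂ] E) : E →ₗ[ℂ] E) =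
      LinearMap.ker ((T ^ (n + 1) : E →L[ℂ] E) : E →ₗ[ℂ] E)}

/-- `z` is a left pole of `T`: `z ∈ σ_a(T)`, the ascent `p` of `T - z I` is finite, and
`R((T - z I)^(p+1))` is closed. -/
def IsLeftPole (T : E →L[ℂ] E) (z : ℂ) : Prop :=
  z ∈ approximateSpectrum T ∧
    ∃ p : ℕ, ascent (shift T z) = p ∧ IsClosed (Set.range (shift T z ^ (p + 1) : E →L[ℂ] E))

/-- The set `p₀₀ᵃ(T)` of left poles `z` of `T` of finite rank, i.e. with `α(T - z I) < ∞`. -/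
def leftPolesFiniteRank (T : E →L[ℂ] E) : Set ℂ :=
  {z | IsLeftPole T z ∧ nullity (shift T z) < ⊤}

/-- Property (az): `σ(T) \ σ_uw(T) = p₀₀ᵃ(T)`. -/
def PropertyAz (T : E →L[ℂ] E) : Prop :=
  spectrum ℂ T \ upperSemiWeylSpectrum T = leftPolesFiniteRank T

/-- Two extended reals have the same sign in the weak sense: both `≤ 0` or both `≥ 0`. -/
def SameSign (a b : EReal) : Prop :=
  (a ≤ 0 ∧ b ≤ 0) ∨ (0 ≤ a ∧ 0 ≤ b)

/-- `S` and `T` have a shared stable sign index: for all `z ∈ ρ_uf(S)` and `w ∈ ρ_uf(T)`, the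
indices of `S - z I` and `T - w I` have the same sign. -/
def SharedStableSignIndex {F : Type*} [NormedAddCommGroup F] [NormedSpace ℂ F]
    (S : E →L[ℂ] E) (T : F →L[ℂ] F) : Prop :=
  ∀ z ∈ upperSemiFredholmResolvent S, ∀ w ∈ upperSemiFredholmResolvent T,
    SameSign (index (shift S z)) (index (shift T w))

end DirectSumAz

namespace DirectSumAz

/-! ### Semi-Fredholm operators and property (az) for one operator. -/

section Single

variable {E : Type*} [NormedAddCommGroup E] [NormedSpace ℂ E]

/-! Property (az) makes two conditions equivalent at every point where T - z is upper semi-Fredholm: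
finite ascent and index ≤ 0 (`PropertyAz.isUpperSemiWeyl`, `PropertyAz.ker_pow_stable`).
Semi-Fredholmness and finite ascent hold for a direct sum exactly when they hold for both summands,
and α and β are additive, so index ≤ 0 passes from the summands to the sum. It passes back once the
two indices have the same sign (`IsUpperSemiWeyl.of_prodMap`), since no cancellation can then occur.
-/

theorem nullity_lt_top_iff {T : E →L[ℂ] E} :
    nullity T < ⊤ ↔ FiniteDimensional ℂ (LinearMap.ker (T : E →ₗ[ℂ] E)) := by
  rw [nullity, Cardinal.toENat_lt_top, Module.rank_lt_aleph0_iff]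

theorem nullity_eq_zero_of_injective {T : E →L[ℂ] E} (h : Function.Injective T) :
    nullity T = 0 := by
  have : LinearMap.ker (T : E →ₗ[ℂ] E) = ⊥ := LinearMap.ker_eq_bot.2 h
  rw [nullity, this]
  simp

/-- An operator is upper semi-Fredholm iff it is bounded below on a closed subspace of finite
codimension. -/
theorem isUpperSemiFredholm_iff_boundedBelow [CompleteSpace E] {T : E →L[ℂ] E} :
    IsUpperSemiFredholm T ↔ ∃ M : Submodule ℂ E, IsClosed (M : Set E) ∧ M.CoFG ∧
      ∃ c : ℝ, 0 < c ∧ ∀ x ∈ M, c * ‖x‖ ≤ ‖T x‖ := by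
  constructor
  · rintro ⟨hcl, hfin⟩
    have hfd := nullity_lt_top_iff.1 hfin
    obtain ⟨M, hM, hc⟩ :=
      (Submodule.ClosedComplemented.of_finiteDimensional
        (LinearMap.ker (T : E →ₗ[ℂ] E))).exists_isClosed_isCompl
    have : CompleteSpace M := hM.completeSpace_coe
    have hinj : Function.Injective (T.domRestrict M) := by
      rw [injective_iff_map_eq_zero]
      rintro ⟨x, hx⟩ h
      have := Submodule.disjoint_def.1 hc.disjoint x (by simpa using h) hx
      simpa using this
    have hran : Set.range (T.domRestrict M) = Set.range T := by
      apply subset_antisymm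
      · rintro _ ⟨x, rfl⟩
        exact ⟨x, rfl⟩
      · rintro _ ⟨x, rfl⟩
        obtain ⟨k, hk, m, hm, rfl⟩ := Submodule.mem_sup.1 
          (show x ∈ LinearMap.ker (T : E →ₗ[ℂ] E) ⊔ M from hc.sup_eq_top ▸ Submodule.mem_top)
        refine ⟨⟨m, hm⟩, ?_⟩
        have : T k = 0 := by simpa using hk
        simp [this]
    obtain ⟨K, hK⟩ := (T.domRestrict M).antilipschitz_of_injective_of_isClosed_range hinj
      (hran ▸ hcl)
    refine ⟨M, hM, Submodule.FG.cofg_of_isCompl hc (Module.Finite.iff_fg.1 hfd),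
      -- Adding 1 keeps the constant positive when K = 0.
      ((K : ℝ) + 1)⁻¹, by positivity, fun x hx ↦ ?_⟩
    have h : ‖x‖ ≤ K * ‖T x‖ := by simpa using hK.le_mul_dist ⟨x, hx⟩ 0
    rw [inv_mul_le_iff₀ (by positivity)]
    nlinarith [norm_nonneg (T x)]
  · rintro ⟨M, hM, hfg, c, hc, hb⟩
    have : CompleteSpace M := hM.completeSpace_coe
    have hanti : AntilipschitzWith (⟨c, hc.le⟩ : NNReal)⁻¹ (T.domRestrict M) := by
      refine AddMonoidHomClass.antilipschitz_of_bound _ fun x ↦ ?_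
      have := hb x x.2
      change ‖(x : E)‖ ≤ c⁻¹ * ‖T x‖
      rwa [le_inv_mul_iff₀ hc]
    have hcl := hanti.isClosed_range (T.domRestrict M).uniformContinuous
    constructor
    -- The range is the closed subspace T(M) plus a finite-dimensional one.
    · refine (T : E →ₗ[ℂ] E).isClosed_range_of_isClosed_map_of_finiteDimensional_quotient (s := M) ?_
      convert hcl using 1
      ext y
      simp
    · rw [nullity_lt_top_iff]
      refine Module.Finite.iff_fg.2 (Submodule.CoFG.fg_of_disjoint ?_ hfg)
      rw [Submodule.disjoint_def]
      intro x hx hxM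
      have h0 : T x = 0 := by simpa using hx
      have := hb x hxM
      rw [h0, norm_zero] at this
      exact norm_le_zero_iff.1 (nonpos_of_mul_nonpos_right this hc)

/-- The preimage of M is the kernel of the induced map F → G/M, whose target is finite-dimensional.
-/
theorem coFG_comap {F G : Type*} [AddCommGroup F] [Module ℂ F] [AddCommGroup G] [Module ℂ G]
    (f : F →ₗ[ℂ] G) {M : Submodule ℂ G} (hM : M.CoFG) : (M.comap f).CoFG := by
  have : (LinearMap.ker (M.mkQ ∘ₗ f)).CoFG := Submodule.CoFG.ker _
  rwa [LinearMap.ker_comp, Submodule.ker_mkQ] at this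

theorem IsUpperSemiFredholm.mul [CompleteSpace E] {A B : E →L[ℂ] E} (hA : IsUpperSemiFredholm A)
    (hB : IsUpperSemiFredholm B) : IsUpperSemiFredholm (A * B) := by
  rw [isUpperSemiFredholm_iff_boundedBelow] at *
  obtain ⟨M, hM, hMf, c, hc, hb⟩ := hA
  obtain ⟨N, hN, hNf, d, hd, hb'⟩ := hB
  refine ⟨N ⊓ M.comap (B : E →ₗ[ℂ] E), hN.inter (hM.preimage B.continuous),
    hNf.inf (coFG_comap _ hMf), c * d, by positivity, fun x hx ↦ ?_⟩
  calc c * d * ‖x‖ = c * (d * ‖x‖) := mul_assoc _ _ _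
    _ ≤ c * ‖B x‖ := by gcongr; exact hb' x hx.1
    _ ≤ ‖A (B x)‖ := hb _ hx.2

theorem IsUpperSemiFredholm.of_mul [CompleteSpace E] {A B : E →L[ℂ] E}
    (h : IsUpperSemiFredholm (A * B)) : IsUpperSemiFredholm B := by
  rw [isUpperSemiFredholm_iff_boundedBelow] at *
  obtain ⟨M, hM, hMf, c, hc, hb⟩ := h
  refine ⟨M, hM, hMf, c / (‖A‖ + 1), by positivity, fun x hx ↦ ?_⟩
  rw [div_mul_eq_mul_div, div_le_iff₀ (by positivity)]
  have h1 : c * ‖x‖ ≤ ‖A (B x)‖ := hb x hx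
  have h2 := A.le_opNorm (B x)
  nlinarith [norm_nonneg (B x)]

theorem isUpperSemiFredholm_of_boundedBelow [CompleteSpace E] {T : E →L[ℂ] E}
    (h : ∃ c : ℝ, 0 < c ∧ ∀ x : E, c * ‖x‖ ≤ ‖T x‖) : IsUpperSemiFredholm T := by
  obtain ⟨c, hc, hb⟩ := h
  exact isUpperSemiFredholm_iff_boundedBelow.2
    ⟨⊤, isClosed_univ, Submodule.CoFG.top, c, hc, fun x _ ↦ hb x⟩

theorem IsUpperSemiFredholm.pow [CompleteSpace E] {T : E →L[ℂ] E} (h : IsUpperSemiFredholm T)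
    (n : ℕ) : IsUpperSemiFredholm (T ^ n) := by
  induction n with
  | zero => exact isUpperSemiFredholm_of_boundedBelow ⟨1, one_pos, fun x ↦ by simp⟩
  | succ n ih => exact pow_succ T n ▸ ih.mul h

/-- T maps ker Tⁿ⁺¹ into ker Tⁿ, with kernel inside ker T. -/
theorem nullity_pow_lt_top {T : E →L[ℂ] E} (h : nullity T < ⊤) (n : ℕ) :
    nullity (T ^ n) < ⊤ := by
  rw [nullity_lt_top_iff] at *
  induction n with
  | zero =>
    have : LinearMap.ker ((T ^ 0 : E →L[ℂ] E) : E →ₗ[ℂ] E) = ⊥ :=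
      LinearMap.ker_eq_bot.2 fun x y h ↦ by simpa using h
    rw [this]
    infer_instance
  | succ n ih =>
    refine Module.Finite.iff_fg.2 (Submodule.fg_of_fg_map_of_fg_inf_ker (T : E →ₗ[ℂ] E) ?_ ?_)
    · refine Module.Finite.iff_fg.1 (Submodule.finiteDimensional_of_le
        (S₂ := LinearMap.ker ((T ^ n : E →L[ℂ] E) : E →ₗ[ℂ] E)) ?_)
      rintro _ ⟨x, hx, rfl⟩
      simpa [pow_succ] using hx
    · exact Module.Finite.iff_fg.1 (Submodule.finiteDimensional_of_le (inf_le_right))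

/-- The power p + 1 has closed range and finite nullity, and semi-Fredholmness of a product passes
to its right factor. -/
theorem isUpperSemiFredholm_of_isLeftPole [CompleteSpace E] {T : E →L[ℂ] E} {z : ℂ}
    (h : IsLeftPole T z) (hz : nullity (shift T z) < ⊤) : IsUpperSemiFredholm (shift T z) := by
  obtain ⟨-, p, -, hcl⟩ := h
  have : IsUpperSemiFredholm (shift T z ^ (p + 1)) := ⟨hcl, nullity_pow_lt_top hz _⟩
  rw [pow_succ] at this
  exact this.of_mul

/-- The ascent of `T` is finite iff the kernels of the powers of `T` stabilise. -/
theorem exists_ascent_eq_iff {T : E →L[ℂ] E} :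
    (∃ p : ℕ, ascent T = p) ↔ ∃ n : ℕ, ∀ x, (T ^ (n + 1)) x = 0 → (T ^ n) x = 0 := by
  have key (n : ℕ) : LinearMap.ker ((T ^ n : E →L[ℂ] E) : E →ₗ[ℂ] E) =
      LinearMap.ker ((T ^ (n + 1) : E →L[ℂ] E) : E →ₗ[ℂ] E) ↔
      ∀ x, (T ^ (n + 1)) x = 0 → (T ^ n) x = 0 := by
    constructor
    · intro h x hx
      exact (SetLike.ext_iff.1 h x).2 hx
    · intro h
      refine le_antisymm (fun x hx ↦ ?_) h
      have : (T ^ n) x = 0 := hx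
      change (T ^ (n + 1)) x = 0
      rw [pow_succ', mul_apply_eq_comp, this, map_zero]
  constructor
  · rintro ⟨p, hp⟩
    have hne : {m : ℕ∞ | ∃ n : ℕ, m = n ∧ LinearMap.ker ((T ^ n : E →L[ℂ] E) : E →ₗ[ℂ] E) =
        LinearMap.ker ((T ^ (n + 1) : E →L[ℂ] E) : E →ₗ[ℂ] E)}.Nonempty := by
      by_contra hne
      rw [Set.not_nonempty_iff_eq_empty] at hne
      rw [ascent, hne, sInf_empty] at hp
      exact ENat.top_ne_natCast p hp
    obtain ⟨n, -, hn⟩ := csInf_mem hne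
    exact ⟨n, (key n).1 hn⟩
  · rintro ⟨n, hn⟩
    have : ascent T ≤ n := sInf_le ⟨n, rfl, (key n).2 hn⟩
    obtain ⟨p, hp⟩ := ENat.ne_top_iff_exists.1 (ne_top_of_le_ne_top (ENat.natCast_ne_top n) this)
    exact ⟨p, hp.symm⟩

theorem ker_pow_stable {T : E →L[ℂ] E} {n m : ℕ} (hnm : n ≤ m)
    (h : ∀ x, (T ^ (n + 1)) x = 0 → (T ^ n) x = 0) (x : E) (hx : (T ^ (m + 1)) x = 0) :
    (T ^ m) x = 0 := by
  obtain ⟨k, rfl⟩ := Nat.exists_eq_add_of_le hnm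
  have h1 := h ((T ^ k) x)
  rw [← mul_apply_eq_comp, ← mul_apply_eq_comp, ← pow_add, ← pow_add] at h1
  exact h1 (by rwa [add_right_comm])

/-- Removes the exact ascent p from the closed range condition, so that summands with different
ascents can be treated together. -/
theorem mem_leftPolesFiniteRank [CompleteSpace E] {T : E →L[ℂ] E} {z : ℂ} :
    z ∈ leftPolesFiniteRank T ↔ z ∈ approximateSpectrum T ∧ IsUpperSemiFredholm (shift T z) ∧
      ∃ n : ℕ, ∀ x, (shift T z ^ (n + 1)) x = 0 → (shift T z ^ n) x = 0 := by
  constructor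
  · rintro ⟨h, hz⟩
    refine ⟨h.1, isUpperSemiFredholm_of_isLeftPole h hz, exists_ascent_eq_iff.1 ?_⟩
    obtain ⟨-, p, hp, -⟩ := h
    exact ⟨p, hp⟩
  · rintro ⟨h1, h2, h3⟩
    obtain ⟨p, hp⟩ := exists_ascent_eq_iff.2 h3
    exact ⟨⟨h1, p, hp, (h2.pow _).1⟩, h2.2⟩

theorem mem_spectrum_iff {T : E →L[ℂ] E} {z : ℂ} : z ∈ spectrum ℂ T ↔ ¬ IsUnit (shift T z) := by
  rw [spectrum.mem_iff, ← IsUnit.neg_iff, neg_sub]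
  rfl

theorem boundedBelow_of_isUnit {T : E →L[ℂ] E} (h : IsUnit T) :
    ∃ c : ℝ, 0 < c ∧ ∀ x : E, c * ‖x‖ ≤ ‖T x‖ := by
  obtain ⟨u, rfl⟩ := h
  refine ⟨(‖(↑u⁻¹ : E →L[ℂ] E)‖ + 1)⁻¹, by positivity, fun x ↦ ?_⟩
  rw [inv_mul_le_iff₀ (by positivity)]
  have h1 : (↑u⁻¹ : E →L[ℂ] E) ((u : E →L[ℂ] E) x) = x := by
    rw [← mul_apply_eq_comp, Units.inv_mul, one_apply_eq_self]
  have h2 := (↑u⁻¹ : E →L[ℂ] E).le_opNorm ((u : E →L[ℂ] E) x)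
  rw [h1] at h2
  nlinarith [norm_nonneg ((u : E →L[ℂ] E) x)]

theorem approximateSpectrum_subset_spectrum (T : E →L[ℂ] E) :
    approximateSpectrum T ⊆ spectrum ℂ T := fun _ hz ↦
  mem_spectrum_iff.2 fun hu ↦ hz (boundedBelow_of_isUnit hu)

theorem injective_of_boundedBelow {T : E →L[ℂ] E}
    (h : ∃ c : ℝ, 0 < c ∧ ∀ x : E, c * ‖x‖ ≤ ‖T x‖) : Function.Injective T := by
  obtain ⟨c, hc, hb⟩ := h
  rw [injective_iff_map_eq_zero]
  intro x hx
  have := hb x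
  rw [hx, norm_zero] at this
  exact norm_le_zero_iff.1 (nonpos_of_mul_nonpos_right this hc)

/-- Comparing α and β in `ℕ∞` replaces subtraction in `EReal` and lets additivity be used directly.
-/
theorem index_nonpos_iff {T : E →L[ℂ] E} (h : nullity T < ⊤) :
    index T ≤ 0 ↔ nullity T ≤ deficiency T := by
  rw [index]
  generalize nullity T = a at *
  generalize deficiency T = b
  lift a to ℕ using h.ne
  induction b using ENat.recTopCoe with
  | top => simp
  | coe b =>
    rw [EReal.sub_nonpos]
    simp

theorem index_nonneg_iff {T : E →L[ℂ] E} (h : nullity T < ⊤) :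
    0 ≤ index T ↔ deficiency T ≤ nullity T := by
  rw [index]
  generalize nullity T = a at *
  generalize deficiency T = b
  lift a to ℕ using h.ne
  induction b using ENat.recTopCoe with
  | top => simp
  | coe b =>
    rw [EReal.sub_nonneg (by simp) (by simp)]
    simp

theorem isUpperSemiWeyl_iff {T : E →L[ℂ] E} :
    IsUpperSemiWeyl T ↔ IsUpperSemiFredholm T ∧ nullity T ≤ deficiency T :=
  and_congr_right fun h ↦ index_nonpos_iff h.2

theorem PropertyAz.isUpperSemiWeyl [CompleteSpace E] {T : E →L[ℂ] E} (hT : PropertyAz T) {z : ℂ}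
    (hF : IsUpperSemiFredholm (shift T z))
    (hA : ∃ n : ℕ, ∀ x, (shift T z ^ (n + 1)) x = 0 → (shift T z ^ n) x = 0) :
    IsUpperSemiWeyl (shift T z) := by
  by_cases hz : z ∈ approximateSpectrum T
  · have : z ∈ spectrum ℂ T \ upperSemiWeylSpectrum T := by
      rw [show _ = _ from hT]
      exact mem_leftPolesFiniteRank.2 ⟨hz, hF, hA⟩
    exact not_not.1 this.2
  · rw [isUpperSemiWeyl_iff, nullity_eq_zero_of_injective (injective_of_boundedBelow (not_not.1 hz))]
    exact ⟨hF, zero_le⟩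

theorem PropertyAz.ker_pow_stable [CompleteSpace E] {T : E →L[ℂ] E} (hT : PropertyAz T) {z : ℂ}
    (hW : IsUpperSemiWeyl (shift T z)) :
    ∃ n : ℕ, ∀ x, (shift T z ^ (n + 1)) x = 0 → (shift T z ^ n) x = 0 := by
  by_cases hz : z ∈ spectrum ℂ T
  · have : z ∈ spectrum ℂ T \ upperSemiWeylSpectrum T := ⟨hz, not_not.2 hW⟩
    rw [show _ = _ from hT] at this
    exact (mem_leftPolesFiniteRank.1 this).2.2
  · have hinj := injective_of_boundedBelow (boundedBelow_of_isUnit (not_not.1 (mt mem_spectrum_iff.2 hz)))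
    refine ⟨0, fun x hx ↦ hinj ?_⟩
    simpa using hx

end Single

/-! ### Direct sums of operators. -/

section Prod

variable {X : Type*} [NormedAddCommGroup X] [NormedSpace ℂ X]
  {Y : Type*} [NormedAddCommGroup Y] [NormedSpace ℂ Y]

theorem shift_prodMap (S : X →L[ℂ] X) (T : Y →L[ℂ] Y) (z : ℂ) :
    shift (S.prodMap T) z = (shift S z).prodMap (shift T z) := by
  ext <;> simp [shift]

theorem prodMap_pow (S : X →L[ℂ] X) (T : Y →L[ℂ] Y) (n : ℕ) :
    S.prodMap T ^ n = (S ^ n).prodMap (T ^ n) := by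
  induction n with
  | zero => ext <;> simp
  | succ n ih => rw [pow_succ, ih, pow_succ, pow_succ]; ext <;> simp

theorem ker_pow_stable_prodMap_iff {S : X →L[ℂ] X} {T : Y →L[ℂ] Y} :
    (∃ n : ℕ, ∀ x, (S.prodMap T ^ (n + 1)) x = 0 → (S.prodMap T ^ n) x = 0) ↔
      (∃ n : ℕ, ∀ x, (S ^ (n + 1)) x = 0 → (S ^ n) x = 0) ∧
      ∃ n : ℕ, ∀ x, (T ^ (n + 1)) x = 0 → (T ^ n) x = 0 := by
  simp only [prodMap_pow]
  constructor
  · rintro ⟨n, hn⟩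
    refine ⟨⟨n, fun x hx ↦ ?_⟩, ⟨n, fun y hy ↦ ?_⟩⟩
    · exact congrArg Prod.fst (hn (x, 0) (Prod.ext hx (map_zero (T ^ (n + 1)))))
    · exact congrArg Prod.snd (hn (0, y) (Prod.ext (map_zero (S ^ (n + 1))) hy))
  · rintro ⟨⟨n, hn⟩, ⟨m, hm⟩⟩
    refine ⟨max n m, fun x hx ↦ Prod.ext ?_ ?_⟩
    · exact ker_pow_stable (le_max_left n m) hn x.1 (congrArg Prod.fst hx)
    · exact ker_pow_stable (le_max_right n m) hm x.2 (congrArg Prod.snd hx)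

theorem boundedBelow_prodMap {S : X →L[ℂ] X} {T : Y →L[ℂ] Y} {M : Set X} {N : Set Y}
    (hS : ∃ c : ℝ, 0 < c ∧ ∀ x ∈ M, c * ‖x‖ ≤ ‖S x‖)
    (hT : ∃ c : ℝ, 0 < c ∧ ∀ y ∈ N, c * ‖y‖ ≤ ‖T y‖) :
    ∃ c : ℝ, 0 < c ∧ ∀ x ∈ M ×ˢ N, c * ‖x‖ ≤ ‖S.prodMap T x‖ := by
  obtain ⟨c, hc, hb⟩ := hS
  obtain ⟨d, hd, hb'⟩ := hT
  refine ⟨min c d, lt_min hc hd, ?_⟩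
  rintro ⟨x, y⟩ ⟨hx, hy⟩
  have h : 0 ≤ min c d := (lt_min hc hd).le
  rw [Prod.norm_def, mul_max_of_nonneg _ _ h]
  refine max_le_max ((mul_le_mul_of_nonneg_right (min_le_left _ _) (norm_nonneg _)).trans (hb x hx))
    ((mul_le_mul_of_nonneg_right (min_le_right _ _) (norm_nonneg _)).trans (hb' y hy))

theorem isUpperSemiFredholm_prodMap_iff [CompleteSpace X] [CompleteSpace Y] {S : X →L[ℂ] X}
    {T : Y →L[ℂ] Y} :
    IsUpperSemiFredholm (S.prodMap T) ↔ IsUpperSemiFredholm S ∧ IsUpperSemiFredholm T := by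
  simp only [isUpperSemiFredholm_iff_boundedBelow]
  constructor
  · rintro ⟨M, hM, hMf, c, hc, hb⟩
    refine ⟨⟨M.comap (LinearMap.inl ℂ X Y), hM.preimage (by fun_prop : Continuous fun x : X ↦ (x, (0 : Y))),
      coFG_comap _ hMf, c, hc, fun x hx ↦ ?_⟩,
      ⟨M.comap (LinearMap.inr ℂ X Y), hM.preimage (by fun_prop : Continuous fun y : Y ↦ ((0 : X), y)),
      coFG_comap _ hMf, c, hc, fun y hy ↦ ?_⟩⟩
    · simpa [Prod.norm_def] using hb (x, 0) hx
    · simpa [Prod.norm_def] using hb (0, y) hy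
  · rintro ⟨⟨M, hM, hMf, hb⟩, ⟨N, hN, hNf, hb'⟩⟩
    refine ⟨M.comap (LinearMap.fst ℂ X Y) ⊓ N.comap (LinearMap.snd ℂ X Y),
      (hM.preimage continuous_fst).inter (hN.preimage continuous_snd),
      (coFG_comap _ hMf).inf (coFG_comap _ hNf), ?_⟩
    exact boundedBelow_prodMap (M := (M : Set X)) (N := (N : Set Y)) hb hb'

theorem nullity_prodMap (S : X →L[ℂ] X) (T : Y →L[ℂ] Y) :
    nullity (S.prodMap T) = nullity S + nullity T := by
  let f : (LinearMap.ker (S : X →ₗ[ℂ] X) × LinearMap.ker (T : Y →ₗ[ℂ] Y)) →ₗ[ℂ] X × Y :=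
    (LinearMap.ker (S : X →ₗ[ℂ] X)).subtype.prodMap (LinearMap.ker (T : Y →ₗ[ℂ] Y)).subtype
  have hf : Function.Injective f := Subtype.val_injective.prodMap Subtype.val_injective
  have hr : LinearMap.range f = LinearMap.ker (S.prodMap T : X × Y →ₗ[ℂ] X × Y) := by
    simp [f]
  rw [nullity, ← hr, (LinearEquiv.ofInjective f hf).symm.rank_eq, rank_prod, map_add,
    Cardinal.toENat_lift, Cardinal.toENat_lift, nullity, nullity]

theorem deficiency_prodMap (S : X →L[ℂ] X) (T : Y →L[ℂ] Y) :
    deficiency (S.prodMap T) = deficiency S + deficiency T := by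
  let f : X × Y →ₗ[ℂ] (X ⧸ LinearMap.range (S : X →ₗ[ℂ] X)) × (Y ⧸ LinearMap.range (T : Y →ₗ[ℂ] Y)) :=
    (LinearMap.range (S : X →ₗ[ℂ] X)).mkQ.prodMap (LinearMap.range (T : Y →ₗ[ℂ] Y)).mkQ
  have hf : Function.Surjective f :=
    (Submodule.mkQ_surjective _).prodMap (Submodule.mkQ_surjective _)
  have hk : LinearMap.ker f = LinearMap.range (S.prodMap T : X × Y →ₗ[ℂ] X × Y) := by
    simp [f]
  rw [deficiency, ← hk, (f.quotKerEquivOfSurjective hf).rank_eq, rank_prod, map_add,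
    Cardinal.toENat_lift, Cardinal.toENat_lift, deficiency, deficiency]

theorem isUnit_prodMap {S : X →L[ℂ] X} {T : Y →L[ℂ] Y} (hS : IsUnit S) (hT : IsUnit T) :
    IsUnit (S.prodMap T) := by
  obtain ⟨u, rfl⟩ := hS
  obtain ⟨v, rfl⟩ := hT
  refine ⟨⟨_, (↑u⁻¹ : X →L[ℂ] X).prodMap (↑v⁻¹ : Y →L[ℂ] Y), ?_, ?_⟩, rfl⟩
  all_goals
    refine ContinuousLinearMap.ext fun x ↦ Prod.ext ?_ ?_ <;>
    simp [← mul_apply_eq_comp]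

theorem mem_approximateSpectrum_of_prodMap {S : X →L[ℂ] X} {T : Y →L[ℂ] Y} {z : ℂ}
    (h : z ∈ approximateSpectrum S ∨ z ∈ approximateSpectrum T) :
    z ∈ approximateSpectrum (S.prodMap T) := by
  rintro ⟨c, hc, hb⟩
  rw [shift_prodMap] at hb
  rcases h with h | h
  · exact h ⟨c, hc, fun x ↦ by simpa [Prod.norm_def] using hb (x, 0)⟩
  · exact h ⟨c, hc, fun y ↦ by simpa [Prod.norm_def] using hb (0, y)⟩

theorem isUpperSemiWeyl_prodMap [CompleteSpace X] [CompleteSpace Y] {S : X →L[ℂ] X}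
    {T : Y →L[ℂ] Y} (hS : IsUpperSemiWeyl S) (hT : IsUpperSemiWeyl T) :
    IsUpperSemiWeyl (S.prodMap T) := by
  rw [isUpperSemiWeyl_iff] at *
  rw [nullity_prodMap, deficiency_prodMap, isUpperSemiFredholm_prodMap_iff]
  exact ⟨⟨hS.1, hT.1⟩, add_le_add hS.2 hT.2⟩

theorem IsUpperSemiWeyl.of_prodMap [CompleteSpace X] [CompleteSpace Y] {S : X →L[ℂ] X}
    {T : Y →L[ℂ] Y} (h : IsUpperSemiWeyl (S.prodMap T)) (hST : SameSign (index S) (index T)) :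
    IsUpperSemiWeyl S ∧ IsUpperSemiWeyl T := by
  simp only [isUpperSemiWeyl_iff] at *
  rw [nullity_prodMap, deficiency_prodMap, isUpperSemiFredholm_prodMap_iff] at h
  obtain ⟨⟨hS, hT⟩, hle⟩ := h
  rw [SameSign, index_nonpos_iff hS.2, index_nonpos_iff hT.2, index_nonneg_iff hS.2,
    index_nonneg_iff hT.2] at hST
  refine ⟨⟨hS, ?_⟩, hT, ?_⟩ <;> rcases hST with hs | hs
  · exact hs.1
  -- α(S) + α(T) ≤ β(S) + β(T) ≤ β(S) + α(T); the finite α(T) cancels.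
  · exact (ENat.add_le_add_iff_right hT.2.ne).1 (hle.trans (add_le_add_right hs.2 _))
  · exact hs.2
  · exact (ENat.add_le_add_iff_left hS.2.ne).1 (hle.trans (add_le_add_left hs.1 _))

end Prod

end DirectSumAz

open DirectSumAz in
theorem corollary3p6
    {X : Type*} [NormedAddCommGroup X] [NormedSpace ℂ X] [CompleteSpace X]
    (hX : ¬ FiniteDimensional ℂ X)
    {Y : Type*} [NormedAddCommGroup Y] [NormedSpace ℂ Y] [CompleteSpace Y]
    (hY : ¬ FiniteDimensional ℂ Y)
    (S : X →L[ℂ] X) (T : Y →L[ℂ] Y)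
    (hS : DirectSumAz.PropertyAz S) (hT : DirectSumAz.PropertyAz T)
    (hST : DirectSumAz.SharedStableSignIndex S T) :
    DirectSumAz.PropertyAz (S.prodMap T) := by
  ext z
  rw [mem_leftPolesFiniteRank]
  constructor
  · rintro ⟨hz, hW⟩
    replace hW : IsUpperSemiWeyl (shift (S.prodMap T) z) := not_not.1 hW
    have hF := hW.1
    rw [mem_spectrum_iff] at hz
    rw [shift_prodMap] at hz hW hF ⊢
    obtain ⟨hFS, hFT⟩ := isUpperSemiFredholm_prodMap_iff.1 hF
    obtain ⟨hWS, hWT⟩ := hW.of_prodMap (hST z hFS z hFT)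
    refine ⟨mem_approximateSpectrum_of_prodMap ?_, hF,
      ker_pow_stable_prodMap_iff.2 ⟨hS.ker_pow_stable hWS, hT.ker_pow_stable hWT⟩⟩
    -- One of the shifted summands is not invertible; being upper semi-Weyl, it has a left pole at z
    -- by (az), which places z in its approximate point spectrum.
    by_cases hzS : z ∈ spectrum ℂ S
    · have : z ∈ leftPolesFiniteRank S := hS ▸ ⟨hzS, not_not.2 hWS⟩
      exact Or.inl this.1.1
    · have hzT : z ∈ spectrum ℂ T := by
        rw [mem_spectrum_iff, not_not] at hzS
        exact mem_spectrum_iff.2 fun h ↦ hz (isUnit_prodMap hzS h)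
      have : z ∈ leftPolesFiniteRank T := hT ▸ ⟨hzT, not_not.2 hWT⟩
      exact Or.inr this.1.1
  · rintro ⟨hz, hF, hA⟩
    refine ⟨approximateSpectrum_subset_spectrum _ hz, not_not.2 ?_⟩
    rw [shift_prodMap] at hF hA ⊢
    obtain ⟨hFS, hFT⟩ := isUpperSemiFredholm_prodMap_iff.1 hF
    obtain ⟨hAS, hAT⟩ := ker_pow_stable_prodMap_iff.1 hA
    exact isUpperSemiWeyl_prodMap (hS.isUpperSemiWeyl hFS hAS) (hT.isUpperSemiWeyl hFT hAT)
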